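/- **Setting.** Let $(X,\epsilon)$ and $(\widetilde X,\widetilde\epsilon)$ be random pairs in $\mathbb R^p\times\mathbb R$. Assume that the coordinates of $X$ are square integrable, centred and pairwise independent with $\mathrm{Var}(X_i)=\lambda_i$, that those of $\widetilde X$ are square integrable, centred and pairwise independent with $\mathrm{Var}(\widetilde X_i)=\widetilde\lambda_i$, that $\mathbb E[\epsilon\mid X]=0$, $\mathrm{Var}(\epsilon)=\sigma^2<\infty$, $\mathbb E[\widetilde\epsilon\mid\widetilde X]=0$, $\mathrm{Var}(\widetilde\epsilon)=\widetilde\sigma^2<\infty$, and that $\widetilde\epsilon$ is bounded. Put $\Lambda=\mathrm{diag}(\lambda_1,\dots,\lambda_p)$ and $\widetilde\Lambda=\mathrm{diag}(\widetilde\lambda_1,\dots,\widetilde\lambda_p)$. Assume that $\chi^2=\chi^2(\mathbb P_X\Vert\mathbb P_{\widetilde X})=\int\big(\tfrac{d\mathbb P_X}{d\mathbb P_{\widetilde X}}-1\big)^2d\mathbb P_{\widetilde X}$ is finite (it is $\infty$ if $\mathbb P_X\not\ll\mathbb P_{\widetilde X}$); $\mathbb P_X$ and $\mathbb P_{\widetilde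 X}$ may differ. Let $\mathcal X$ be a set that contains $X$ almost surely. Let $(x_i,\epsilon_i)_{i\ge1}$ be i.i.d. copies of $(X,\epsilon)$ and, independently of them, $(\widetilde x_i,\widetilde\epsilon_i)_{i\ge1}$ i.i.d. copies of $(\widetilde X,\widetilde\epsilon)$. Let $\mu(x)=x^T\beta^*$, $Y=\mu(X)+\epsilon$ and $y_i=x_i^T\beta^*+\epsilon_i$. Write $\mathbb X\in\mathbb R^{n\times p}$ for the matrix with rows $x_1^T,\dots,x_n^T$, $\mathbb Y=(y_1,\dots,y_n)^T$, $\boldsymbol\epsilon=(\epsilon_1,\dots,\epsilon_n)^T$, $\widehat\beta=(\mathbb X^T\mathbb X)^{-1}\mathbb X^T\mathbb Y$ and $\widehat f_{LR}(x)=\widehat\mu(x)=x^T\widehat\beta$. The synthetic responses are $\widetilde y_i=\widetilde x_i^T\widehat\beta+\widetilde\epsilon_i$; with $\widetilde{\mathbb X}\in\mathbb R^{\widetilde n\times p}$, $\widetilde{\mathbb Y}$, $\widetilde{\boldsymbol\epsilon}$ formed in the same way, $\widetilde f_{LR}(x)=x^T(\widetilde{\mathbb X}^T\widetilde{\mathbb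 X})^{-1}\widetilde{\mathbb X}^T\widetilde{\mathbb Y}$. Assume that $\mathbb X^T\mathbb X$ is almost surely invertible for all $n\ge n_0$ and $\widetilde{\mathbb X}^T\widetilde{\mathbb X}$ for all $\widetilde n\ge\widetilde n_0$. Let $\mathbb Q=\mathbb X(\mathbb X^T\mathbb X)^{-1}$, $\widetilde{\mathbb Q}=\widetilde{\mathbb X}(\widetilde{\mathbb X}^T\widetilde{\mathbb X})^{-1}$ and $$M_{LR}=\max\Big\{\sup_{x\in\mathcal X}|x^T\mathbb Q^T\mathbb Y|,\ \sup_{x\in\mathcal X}|x^T\widetilde{\mathbb Q}^T\widetilde{\mathbb Y}|\Big\}\in[0,\infty].$$ For $f:\mathbb R^p\to\mathbb R$ let $R_s(f)=\mathbb E[(f(X)-Y)^2]$, $\Phi_s(f)=\mathbb E[(f(X)-\mu(X))^2]$, and, with the samples held fixed and $(\widetilde X,\widetilde\epsilon)$ a fresh pair, $\widetilde R_s(f)=\mathbb E[(f(\widetilde X)-\widehat\mu(\widetilde X)-\widetilde\epsilon)^2]$ and $\widetilde\Phi_s(f)=\mathbb E[(f(\widetilde X)-\widehat\mu(\widetilde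 X))^2]$. Let $U_r(f,g)=|R_s(f)-R_s(g)|$. **Theorem.** (i) For all $n\ge n_0$ and $\widetilde n\ge\widetilde n_0$, almost surely $U_r(\widetilde f_{LR},\widehat f_{LR})\le B$, where (with $0\cdot\infty=0$) $$\begin{aligned}B={}&13\,\mathrm{trace}\big(\boldsymbol\epsilon\boldsymbol\epsilon^T\mathbb Q\Lambda\mathbb Q^T\big)+\mathrm{trace}\big(\widetilde{\boldsymbol\epsilon}\widetilde{\boldsymbol\epsilon}^T\widetilde{\mathbb Q}\widetilde\Lambda\widetilde{\mathbb Q}^T\big)\\&+2M_{LR}\sqrt{\chi^2}\,\Big\{\sqrt{\mathrm{trace}\big(\widetilde{\boldsymbol\epsilon}\widetilde{\boldsymbol\epsilon}^T\widetilde{\mathbb Q}\widetilde\Lambda\widetilde{\mathbb Q}^T\big)}+\sqrt{\mathrm{trace}\big(\boldsymbol\epsilon\boldsymbol\epsilon^T\mathbb Q\widetilde\Lambda\mathbb Q^T\big)}\Big\}\\&+2\sqrt{2\,\mathrm{trace}\big(\widetilde{\boldsymbol\epsilon}\widetilde{\boldsymbol\epsilon}^T\widetilde{\mathbb Q}\Lambda\widetilde{\mathbb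 Q}^T\big)}\sqrt{\mathrm{trace}\big(\boldsymbol\epsilon\boldsymbol\epsilon^T\mathbb Q\Lambda\mathbb Q^T\big)}.\end{aligned}$$ Moreover, almost surely, $B$ is obtained from the general utility bound: if $f^*$ minimizes $R_s$ and $\widetilde f^*$ minimizes $\widetilde\Phi_s$ over the linear functions $x\mapsto x^T\beta$, and if $\Upsilon_1=\sqrt{\widetilde\Phi_s(\widetilde f_{LR})}+2\sqrt{\widetilde\Phi_s(\widetilde f^*)}+\sqrt{\widetilde\Phi_s(f^*)}$ and $\Upsilon_2=\sqrt{\Phi_s(\widetilde f_{LR})}+2\sqrt{\Phi_s(\widetilde f^*)}+\sqrt{\Phi_s(f^*)}$, then $$U_r(\widetilde f_{LR},\widehat f_{LR})\le|R_s(\widehat f_{LR})-R_s(f^*)|+|\widetilde R_s(\widetilde f_{LR})-\widetilde R_s(\widetilde f^*)|+2M_{LR}\Upsilon_1\sqrt{\chi^2}+2\Upsilon_2\sqrt{\Phi_s(\widehat\mu)}+4\Phi_s(\widehat\mu)\le B.$$ (ii) For every $\delta>0$, $$\lim_{n\to\infty}\lim_{\widetilde n\to\infty}\mathbb P\big(U_r(\widetilde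 f_{LR},\widehat f_{LR})>\delta\big)=0,$$ where the inner limit exists for every $n\ge n_0$ and the randomness comes from $\boldsymbol\epsilon,\widetilde{\boldsymbol\epsilon},\mathbb X,\widetilde{\mathbb X}$. -/

import Mathlib

open MeasureTheory ProbabilityTheory Filter Topology
open scoped ENNReal Matrix

noncomputable section

namespace SyntheticLR

/-- The chi-squared divergence `χ²(P ‖ Q) = ∫ (dP/dQ - 1)² dQ`, equal to `∞` unless `P ≪ Q`. -/
def chiSqDiv {E : Type*} [MeasurableSpace E] (P Q : Measure E) : ℝ≥0∞ :=
  open Classical in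
  if P ≪ Q then ∫⁻ x, ENNReal.ofReal (((P.rnDeriv Q x).toReal - 1) ^ 2) ∂Q else ⊤

/-- The squared-loss risk `E[(f(X) - Y)²]`, where `PXY` is the law of `(X, Y)`. -/
def risk {E : Type*} [MeasurableSpace E] (PXY : Measure (E × ℝ)) (f : E → ℝ) : ℝ :=
  ∫ q, (f q.1 - q.2) ^ 2 ∂PXY

/-- The excess risk `E[(f(X) - g(X))²]` relative to the regression function `g`,
where `PX` is the law of `X`. -/
def excessRisk {E : Type*} [MeasurableSpace E] (PX : Measure E) (g f : E → ℝ) : ℝ :=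
  ∫ x, (f x - g x) ^ 2 ∂PX

/-- The utility metric `|R(f) - R(g)|`. -/
def utility {E : Type*} [MeasurableSpace E] (PXY : Measure (E × ℝ)) (f g : E → ℝ) : ℝ :=
  |risk PXY f - risk PXY g|

/-- `f` is an optimal element of the class `F` for the objective `R`. -/
def IsOptimal {E : Type*} (F : Set (E → ℝ)) (R : (E → ℝ) → ℝ) (f : E → ℝ) : Prop :=
  f ∈ F ∧ ∀ g ∈ F, R f ≤ R g

/-- The general utility bound for regression. `PXY` and `PXYt` are the original and the synthetic
law of features and responses, `μ` and `μhat` the original and the synthetic regression function,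
`fhat` and `ft` the models trained on the original and on the synthetic data, `fs` and `fts` the
optimal functions in the class under the two laws, and `M` the uniform bound. -/
def regressionUtilityBound {E : Type*} [MeasurableSpace E] (PXY PXYt : Measure (E × ℝ))
    (μ μhat fhat ft fs fts : E → ℝ) (M : ℝ≥0∞) : ℝ≥0∞ :=
  let Φ := excessRisk PXY.fst μ
  let Φt := excessRisk PXYt.fst μhat
  let Υ₁ : ℝ := √(Φt ft) + 2 * √(Φt fts) + √(Φt fs)
  let Υ₂ : ℝ := √(Φ ft) + 2 * √(Φ fts) + √(Φ fs)
  ENNReal.ofReal |risk PXY fhat - risk PXY fs|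
    + ENNReal.ofReal |risk PXYt ft - risk PXYt fts|
    + 2 * M * ENNReal.ofReal Υ₁ * chiSqDiv PXY.fst PXYt.fst ^ (1 / 2 : ℝ)
    + ENNReal.ofReal (2 * Υ₂ * √(Φ μhat))
    + ENNReal.ofReal (4 * Φ μhat)

/-- `ν` is the law of a pair (feature vector, noise): the features are square integrable, centred
and pairwise independent, the `i`-th one with variance `lam i`, and the noise has variance `σ ^ 2`
and conditional mean zero given the features. -/
structure IsFeatureNoiseLaw {p : ℕ} (ν : Measure ((Fin p → ℝ) × ℝ)) (lam : Fin p → ℝ) (σ : ℝ) :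
    Prop where
  memLp_feature : ∀ i, MemLp (fun q => q.1 i) 2 ν
  mean_feature : ∀ i, ∫ q, q.1 i ∂ν = 0
  var_feature : ∀ i, Var[fun q => q.1 i; ν] = lam i
  indep_feature : ∀ i j, i ≠ j → IndepFun (fun q => q.1 i) (fun q => q.1 j) ν
  memLp_noise : MemLp (fun q => q.2) 2 ν
  condMean_noise :
    ν[fun q => q.2 | MeasurableSpace.comap Prod.fst inferInstance] =ᵐ[ν] fun _ => (0 : ℝ)
  var_noise : Var[fun q => q.2; ν] = σ ^ 2

/-- The linear function `x ↦ xᵀ β`. -/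
def lin {p : ℕ} (β : Fin p → ℝ) : (Fin p → ℝ) → ℝ := fun x => x ⬝ᵥ β

/-- The class of all linear functions. -/
def linClass (p : ℕ) : Set ((Fin p → ℝ) → ℝ) := Set.range lin

/-- The law of `(X, Xᵀ β + e)` when `(X, e)` has law `ν`. -/
def responseLaw {p : ℕ} (β : Fin p → ℝ) (ν : Measure ((Fin p → ℝ) × ℝ)) :
    Measure ((Fin p → ℝ) × ℝ) :=
  ν.map fun q => (q.1, lin β q.1 + q.2)

/-- The design matrix whose rows are the first `n` feature vectors. -/
def design {p : ℕ} (n : ℕ) (x : ℕ → Fin p → ℝ) : Matrix (Fin n) (Fin p) ℝ :=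
  Matrix.of fun i j => x i j

/-- The vector of the first `n` noise terms. -/
def noise (n : ℕ) (e : ℕ → ℝ) : Fin n → ℝ := fun i => e i

/-- The vector of the responses `yᵢ = xᵢᵀ β + eᵢ`, `i < n`. -/
def responses {p : ℕ} (n : ℕ) (β : Fin p → ℝ) (x : ℕ → Fin p → ℝ) (e : ℕ → ℝ) : Fin n → ℝ :=
  design n x *ᵥ β + noise n e

/-- The ordinary least squares coefficient vector `(AᵀA)⁻¹ Aᵀ Y`. -/
def ols {n p : ℕ} (A : Matrix (Fin n) (Fin p) ℝ) (Y : Fin n → ℝ) : Fin p → ℝ :=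
  ((Aᵀ * A)⁻¹ * Aᵀ) *ᵥ Y

/-- The least squares coefficients fitted on the original data of size `n`. -/
def betaHat {p : ℕ} (n : ℕ) (βs : Fin p → ℝ) (x : ℕ → Fin p → ℝ) (e : ℕ → ℝ) : Fin p → ℝ :=
  ols (design n x) (responses n βs x e)

/-- The least squares coefficients fitted on the synthetic data of size `m`, whose responses are
generated from the original least squares fit. -/
def betaTilde {p : ℕ} (n m : ℕ) (βs : Fin p → ℝ) (x : ℕ → Fin p → ℝ) (e : ℕ → ℝ)
    (xt : ℕ → Fin p → ℝ) (et : ℕ → ℝ) : Fin p → ℝ :=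
  ols (design m xt) (responses m (betaHat n βs x e) xt et)

/-- The matrix `Q = A (AᵀA)⁻¹`. -/
def qMat {n p : ℕ} (A : Matrix (Fin n) (Fin p) ℝ) : Matrix (Fin n) (Fin p) ℝ :=
  A * (Aᵀ * A)⁻¹

/-- `trace (e eᵀ Q Λ Qᵀ)` with `Λ = diag(lam)`. -/
def quadTrace {n p : ℕ} (e : Fin n → ℝ) (Q : Matrix (Fin n) (Fin p) ℝ) (lam : Fin p → ℝ) : ℝ :=
  (Matrix.vecMulVec e e * Q * Matrix.diagonal lam * Qᵀ).trace

/-- `max (sup_{z ∈ S} |zᵀ Qᵀ Y|) (sup_{z ∈ S} |zᵀ Q̃ᵀ Ỹ|)`, with values in `[0, ∞]`. -/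
def supBound {n m p : ℕ} (S : Set (Fin p → ℝ)) (Q : Matrix (Fin n) (Fin p) ℝ) (Y : Fin n → ℝ)
    (Qt : Matrix (Fin m) (Fin p) ℝ) (Yt : Fin m → ℝ) : ℝ≥0∞ :=
  max (⨆ z ∈ S, ENNReal.ofReal |z ⬝ᵥ (Qᵀ *ᵥ Y)|) (⨆ z ∈ S, ENNReal.ofReal |z ⬝ᵥ (Qtᵀ *ᵥ Yt)|)

/-- The explicit trace form of the utility bound; `χ` is the chi-squared divergence and `M` the
uniform bound (with `0 * ∞ = 0`). -/
def traceBound {n m p : ℕ} (e : Fin n → ℝ) (Q : Matrix (Fin n) (Fin p) ℝ)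
    (et : Fin m → ℝ) (Qt : Matrix (Fin m) (Fin p) ℝ) (lam lamt : Fin p → ℝ) (χ M : ℝ≥0∞) : ℝ≥0∞ :=
  ENNReal.ofReal (13 * quadTrace e Q lam) + ENNReal.ofReal (quadTrace et Qt lamt)
    + 2 * M * χ ^ (1 / 2 : ℝ)
        * ENNReal.ofReal (√(quadTrace et Qt lamt) + √(quadTrace e Q lamt))
    + ENNReal.ofReal (2 * √(2 * quadTrace et Qt lam) * √(quadTrace e Q lam))

end SyntheticLR

end

noncomputable section

namespace SyntheticLR

/-! Write D and D̃ for the quadratic forms `diagForm lam` and `diagForm lamt`. Least squares is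
exact up to noise: the original fit is βs + a with a = Qᵀε, and the synthetic fit is βs + a + b with
b = Q̃ᵀε̃. The features are centred and uncorrelated, and the noise is orthogonal to them, so every
risk is a quadratic form in the coefficient error plus a constant. The utility is therefore |D(a +
b) - D(a)|, and the traces are values of D and D̃ at a and b.

For (i), Cauchy–Schwarz bounds the utility by D(a) + D(b) plus multiples of √D(a + b) √D(a) and D(a)
(`diagForm_add_sub_le`). The term D(b) is an error of the synthetic fit measured under the original
law. Since |xᵀb| ≤ 2M on the domain, a χ² change of measure replaces it by D̃(b) + 2M √χ² √D̃(b)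
(`ofReal_integral_sq_le_of_chiSqDiv`). Invertible Gram matrices force positive variances, so D and
D̃ are definite and the optimal linear functions are unique. The general bound then becomes explicit
in a and b (`regressionUtilityBound_lin`), and expanding √D(a + b) gives the trace form.

For (ii), the bound B is of no help, since M may be infinite. Instead n is fixed: the strong law
gives b → 0 almost surely as the synthetic sample grows (`IsFeatureNoiseLaw.ae_tendsto_ols_error`),
and the utility is continuous in b and vanishes at b = 0. Each inner limit is thus already 0. -/

/-- The quadratic form `vᵀ diag(lam) v`. -/
def diagForm {p : ℕ} (lam v : Fin p → ℝ) : ℝ := ∑ i, lam i * v i ^ 2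

/-! ### Least squares algebra -/

section Algebra

variable {n m p : ℕ}

lemma lin_sub (β γ z : Fin p → ℝ) : lin (β - γ) z = lin β z - lin γ z := by
  simp [lin, dotProduct_sub]

lemma lin_eq_sum (β z : Fin p → ℝ) : lin β z = ∑ i, β i * z i := by
  simp [lin, dotProduct, mul_comm]

lemma measurable_lin (β : Fin p → ℝ) : Measurable (lin β) := by
  have : lin β = fun z => ∑ i, β i * z i := funext (lin_eq_sum β)
  rw [this]
  fun_prop

lemma diagForm_nonneg {lam : Fin p → ℝ} (h : ∀ i, 0 < lam i) (v : Fin p → ℝ) :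
    0 ≤ diagForm lam v :=
  Finset.sum_nonneg fun i _ => mul_nonneg (h i).le (sq_nonneg _)

lemma diagForm_zero (lam : Fin p → ℝ) : diagForm lam 0 = 0 := by
  simp [diagForm]

lemma eq_zero_of_diagForm_eq_zero {lam : Fin p → ℝ} (h : ∀ i, 0 < lam i) {v : Fin p → ℝ}
    (hv : diagForm lam v = 0) : v = 0 := by
  funext i
  have := (Finset.sum_eq_zero_iff_of_nonneg
    fun i _ => mul_nonneg (h i).le (sq_nonneg (v i))).1 hv i (Finset.mem_univ i)
  simpa [(h i).ne'] using this

/-- Cyclicity of the trace: each trace in the bound is a weighted squared norm of the estimation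
error Qᵀe. -/
lemma quadTrace_eq (e : Fin n → ℝ) (Q : Matrix (Fin n) (Fin p) ℝ) (lam : Fin p → ℝ) :
    quadTrace e Q lam = diagForm lam (Qᵀ *ᵥ e) := by
  rw [quadTrace, Matrix.mul_assoc, Matrix.mul_assoc, Matrix.vecMulVec_mul, Matrix.trace_vecMulVec,
    ← Matrix.mul_assoc, ← Matrix.vecMul_vecMul, dotProduct_comm, ← Matrix.dotProduct_mulVec,
    ← Matrix.vecMul_vecMul, Matrix.mulVec_transpose]
  simp only [diagForm, dotProduct, Matrix.vecMul_diagonal]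
  exact Finset.sum_congr rfl fun i _ => by ring

lemma qMat_transpose (A : Matrix (Fin n) (Fin p) ℝ) : (qMat A)ᵀ = (Aᵀ * A)⁻¹ * Aᵀ := by
  rw [qMat, Matrix.transpose_mul, Matrix.transpose_nonsing_inv, Matrix.transpose_mul,
    Matrix.transpose_transpose]

lemma ols_eq_qMat (A : Matrix (Fin n) (Fin p) ℝ) (Y : Fin n → ℝ) :
    ols A Y = (qMat A)ᵀ *ᵥ Y := by
  rw [ols, qMat_transpose]

/-- (AᵀA)⁻¹AᵀA = 1 recovers β exactly. As β is arbitrary, this serves both fits: β = `βs` for the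
original one, β = `betaHat` for the synthetic one. -/
lemma ols_responses {x : ℕ → Fin p → ℝ} (β : Fin p → ℝ) (e : ℕ → ℝ)
    (h : IsUnit ((design n x)ᵀ * design n x)) :
    ols (design n x) (responses n β x e) = β + (qMat (design n x))ᵀ *ᵥ noise n e := by
  have hdet := (Matrix.isUnit_iff_isUnit_det _).1 h
  rw [ols_eq_qMat, responses, Matrix.mulVec_add, Matrix.mulVec_mulVec, qMat_transpose,
    Matrix.mul_assoc, Matrix.nonsing_inv_mul _ hdet, Matrix.one_mulVec]

lemma le_supBound_left {S : Set (Fin p → ℝ)} {z : Fin p → ℝ} (hz : z ∈ S)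
    (Q : Matrix (Fin n) (Fin p) ℝ) (Y : Fin n → ℝ) (Qt : Matrix (Fin m) (Fin p) ℝ)
    (Yt : Fin m → ℝ) : ENNReal.ofReal |lin (Qᵀ *ᵥ Y) z| ≤ supBound S Q Y Qt Yt :=
  (le_iSup₂ (f := fun z (_ : z ∈ S) => ENNReal.ofReal |z ⬝ᵥ (Qᵀ *ᵥ Y)|) z hz).trans
    (le_max_left _ _)

lemma le_supBound_right {S : Set (Fin p → ℝ)} {z : Fin p → ℝ} (hz : z ∈ S)
    (Q : Matrix (Fin n) (Fin p) ℝ) (Y : Fin n → ℝ) (Qt : Matrix (Fin m) (Fin p) ℝ)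
    (Yt : Fin m → ℝ) : ENNReal.ofReal |lin (Qtᵀ *ᵥ Yt) z| ≤ supBound S Q Y Qt Yt :=
  (le_iSup₂ (f := fun z (_ : z ∈ S) => ENNReal.ofReal |z ⬝ᵥ (Qtᵀ *ᵥ Yt)|) z hz).trans
    (le_max_right _ _)

end Algebra

/-! ### Second moments and risks of linear functions -/

section Moments

variable {p : ℕ} {ν : Measure ((Fin p → ℝ) × ℝ)} {lam : Fin p → ℝ} {σ : ℝ}

lemma IsFeatureNoiseLaw.integrable_feature_mul (h : IsFeatureNoiseLaw ν lam σ) (i j : Fin p) :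
    Integrable (fun q => q.1 i * q.1 j) ν :=
  (h.memLp_feature i).integrable_mul (h.memLp_feature j)

lemma IsFeatureNoiseLaw.integral_feature_mul (h : IsFeatureNoiseLaw ν lam σ) (i j : Fin p) :
    ∫ q, q.1 i * q.1 j ∂ν = if i = j then lam i else 0 := by
  split_ifs with hij
  · subst hij
    rw [← h.var_feature i, variance_of_integral_eq_zero (h.memLp_feature i).1.aemeasurable
      (h.mean_feature i)]
    simp [sq]
  · rw [(h.indep_feature i j hij).integral_fun_mul_eq_mul_integral (h.memLp_feature i).1
      (h.memLp_feature j).1, h.mean_feature, zero_mul]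

lemma IsFeatureNoiseLaw.integrable_feature_mul_noise (h : IsFeatureNoiseLaw ν lam σ)
    (i : Fin p) : Integrable (fun q => q.1 i * q.2) ν :=
  (h.memLp_feature i).integrable_mul h.memLp_noise

/-- Tower property: the feature is pulled out of the conditional expectation of the noise, which is
zero. -/
lemma IsFeatureNoiseLaw.integral_feature_mul_noise [IsProbabilityMeasure ν]
    (h : IsFeatureNoiseLaw ν lam σ) (i : Fin p) :
    ∫ q, q.1 i * q.2 ∂ν = 0 := by
  have hm : MeasurableSpace.comap (Prod.fst : (Fin p → ℝ) × ℝ → _) inferInstance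
      ≤ (inferInstance : MeasurableSpace ((Fin p → ℝ) × ℝ)) := measurable_fst.comap_le
  have hf : StronglyMeasurable[MeasurableSpace.comap (Prod.fst : (Fin p → ℝ) × ℝ → _)
      inferInstance] (fun q : (Fin p → ℝ) × ℝ => q.1 i) :=
    (@Measurable.comp _ _ _ (_) _ _ _ _ (measurable_pi_apply i)
      (comap_measurable Prod.fst)).stronglyMeasurable
  rw [← integral_condExp hm]
  apply integral_eq_zero_of_ae
  filter_upwards [condExp_mul_of_stronglyMeasurable_left hf (h.integrable_feature_mul_noise i)
    (h.memLp_noise.integrable one_le_two), h.condMean_noise] with q h1 h2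
  have h3 : ν[fun q => q.1 i * q.2 | MeasurableSpace.comap Prod.fst inferInstance] q
    = q.1 i * ν[fun q => q.2 | MeasurableSpace.comap Prod.fst inferInstance] q := h1
  rw [h3, h2]
  simp

lemma IsFeatureNoiseLaw.integral_noise_sq [IsProbabilityMeasure ν]
    (h : IsFeatureNoiseLaw ν lam σ) :
    ∫ q, q.2 ^ 2 ∂ν = σ ^ 2 := by
  have hm : MeasurableSpace.comap (Prod.fst : (Fin p → ℝ) × ℝ → _) inferInstance
      ≤ (inferInstance : MeasurableSpace ((Fin p → ℝ) × ℝ)) := measurable_fst.comap_le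
  have h0 : ∫ q, q.2 ∂ν = 0 := by
    rw [← integral_condExp hm]
    exact integral_eq_zero_of_ae h.condMean_noise
  rw [← h.var_noise, variance_of_integral_eq_zero h.memLp_noise.1.aemeasurable h0]

lemma IsFeatureNoiseLaw.memLp_lin (h : IsFeatureNoiseLaw ν lam σ) (v : Fin p → ℝ) :
    MemLp (fun q => lin v q.1) 2 ν := by
  simp only [lin_eq_sum]
  exact memLp_finsetSum _ fun i _ => (h.memLp_feature i).const_mul (v i)

/-- Pairwise independence and centring kill the off-diagonal terms of the expanded square. -/
lemma IsFeatureNoiseLaw.integral_lin_sq (h : IsFeatureNoiseLaw ν lam σ) (v : Fin p → ℝ) :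
    ∫ q, lin v q.1 ^ 2 ∂ν = diagForm lam v := by
  have hexp : ∀ q : (Fin p → ℝ) × ℝ,
      lin v q.1 ^ 2 = ∑ i, ∑ j, v i * v j * (q.1 i * q.1 j) := fun q => by
    rw [lin_eq_sum, sq, Finset.sum_mul_sum]
    exact Finset.sum_congr rfl fun i _ => Finset.sum_congr rfl fun j _ => by ring
  simp_rw [hexp]
  rw [integral_finsetSum _ fun i _ => integrable_finsetSum _ fun j _ =>
    (h.integrable_feature_mul i j).const_mul _, diagForm]
  refine Finset.sum_congr rfl fun i _ => ?_
  rw [integral_finsetSum _ fun j _ => (h.integrable_feature_mul i j).const_mul _]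
  simp_rw [integral_const_mul, h.integral_feature_mul]
  simp
  ring

lemma IsFeatureNoiseLaw.integral_lin_mul_noise [IsProbabilityMeasure ν]
    (h : IsFeatureNoiseLaw ν lam σ) (v : Fin p → ℝ) :
    ∫ q, lin v q.1 * q.2 ∂ν = 0 := by
  simp_rw [lin_eq_sum, Finset.sum_mul, mul_assoc]
  rw [integral_finsetSum _ fun i _ => (h.integrable_feature_mul_noise i).const_mul _]
  simp_rw [integral_const_mul, h.integral_feature_mul_noise]
  simp

lemma IsFeatureNoiseLaw.integral_fst_lin_sq (h : IsFeatureNoiseLaw ν lam σ) (v : Fin p → ℝ) :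
    ∫ z, lin v z ^ 2 ∂ν.fst = diagForm lam v := by
  rw [Measure.fst, integral_map measurable_fst.aemeasurable
    ((measurable_lin v).pow_const 2).aestronglyMeasurable, h.integral_lin_sq]

lemma IsFeatureNoiseLaw.integrable_fst_lin_sq (h : IsFeatureNoiseLaw ν lam σ) (v : Fin p → ℝ) :
    Integrable (fun z => lin v z ^ 2) ν.fst := by
  rw [Measure.fst, integrable_map_measure ((measurable_lin v).pow_const 2).aestronglyMeasurable
    measurable_fst.aemeasurable]
  exact (h.memLp_lin v).integrable_sq

lemma IsFeatureNoiseLaw.excessRisk_lin (h : IsFeatureNoiseLaw ν lam σ) (β γ : Fin p → ℝ) :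
    excessRisk ν.fst (lin β) (lin γ) = diagForm lam (γ - β) := by
  simp_rw [excessRisk, ← lin_sub, h.integral_fst_lin_sq]

lemma measurable_response (β : Fin p → ℝ) :
    Measurable fun q : (Fin p → ℝ) × ℝ => (q.1, lin β q.1 + q.2) :=
  measurable_fst.prodMk (((measurable_lin β).comp measurable_fst).add measurable_snd)

lemma responseLaw_fst (β : Fin p → ℝ) : (responseLaw β ν).fst = ν.fst := by
  rw [responseLaw, Measure.fst, Measure.map_map measurable_fst (measurable_response β)]
  rfl

/-- The cross term between features and noise integrates to zero, leaving excess risk plus noise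
variance. -/
lemma IsFeatureNoiseLaw.risk_lin [IsProbabilityMeasure ν]
    (h : IsFeatureNoiseLaw ν lam σ) (β γ : Fin p → ℝ) :
    risk (responseLaw β ν) (lin γ) = diagForm lam (γ - β) + σ ^ 2 := by
  have hmeas : Measurable fun q : (Fin p → ℝ) × ℝ => (lin γ q.1 - q.2) ^ 2 :=
    (((measurable_lin γ).comp measurable_fst).sub measurable_snd).pow_const 2
  rw [risk, responseLaw, integral_map (measurable_response β).aemeasurable
    hmeas.aestronglyMeasurable]
  have hexp : ∀ q : (Fin p → ℝ) × ℝ, (lin γ q.1 - (lin β q.1 + q.2)) ^ 2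
      = lin (γ - β) q.1 ^ 2 - 2 * (lin (γ - β) q.1 * q.2) + q.2 ^ 2 := fun q => by
    rw [lin_sub]; ring
  simp_rw [hexp]
  have h1 := (h.memLp_lin (γ - β)).integrable_sq
  have h2 : Integrable (fun q => 2 * (lin (γ - β) q.1 * q.2)) ν :=
    ((h.memLp_lin (γ - β)).integrable_mul h.memLp_noise).const_mul 2
  have h12 : Integrable (fun q => lin (γ - β) q.1 ^ 2 - 2 * (lin (γ - β) q.1 * q.2)) ν := h1.sub h2
  rw [integral_add h12 h.memLp_noise.integrable_sq, integral_sub h1 h2,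
    integral_const_mul, h.integral_lin_sq, h.integral_lin_mul_noise, h.integral_noise_sq]
  ring

end Moments

/-! ### Change of measure by the χ² divergence -/

section ChiSq

variable {E : Type*} [MeasurableSpace E] {P Q : Measure E}

lemma absolutelyContinuous_of_chiSqDiv_lt_top (h : chiSqDiv P Q < ⊤) : P ≪ Q := by
  by_contra hac
  simp [chiSqDiv, hac] at h

lemma chiSqDiv_of_ac (h : P ≪ Q) :
    chiSqDiv P Q = ∫⁻ x, ENNReal.ofReal (((P.rnDeriv Q x).toReal - 1) ^ 2) ∂Q := by
  simp [chiSqDiv, h]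

lemma memLp_rnDeriv_sub_one (h : chiSqDiv P Q < ⊤) :
    MemLp (fun x => (P.rnDeriv Q x).toReal - 1) 2 Q := by
  have hac := absolutelyContinuous_of_chiSqDiv_lt_top h
  have hmeas : Measurable fun x => (P.rnDeriv Q x).toReal - 1 :=
    (Measure.measurable_rnDeriv P Q).ennreal_toReal.sub_const 1
  rw [memLp_two_iff_integrable_sq hmeas.aestronglyMeasurable]
  refine ⟨(hmeas.pow_const 2).aestronglyMeasurable, ?_⟩
  rw [hasFiniteIntegral_iff_ofReal (ae_of_all _ fun _ => sq_nonneg _), ← chiSqDiv_of_ac hac]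
  exact h

lemma integral_rnDeriv_sub_one_sq (h : chiSqDiv P Q < ⊤) :
    ∫ x, ((P.rnDeriv Q x).toReal - 1) ^ 2 ∂Q = (chiSqDiv P Q).toReal := by
  rw [integral_eq_lintegral_of_nonneg_ae (ae_of_all _ fun _ => sq_nonneg _)
    (memLp_rnDeriv_sub_one h).integrable_sq.1,
    chiSqDiv_of_ac (absolutelyContinuous_of_chiSqDiv_lt_top h)]

lemma integral_abs_mul_abs_le {u v : E → ℝ} (hu : MemLp u 2 Q) (hv : MemLp v 2 Q) :
    ∫ x, |u x| * |v x| ∂Q ≤ √(∫ x, u x ^ 2 ∂Q) * √(∫ x, v x ^ 2 ∂Q) := by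
  have h := integral_mul_norm_le_Lp_mul_Lq (p := 2) (q := 2) (f := u) (g := v) (μ := Q)
    Real.HolderConjugate.two_two (by simpa using hu) (by simpa using hv)
  simpa [Real.sqrt_eq_rpow] using h

variable [IsProbabilityMeasure P] [IsProbabilityMeasure Q]

/-- With r = dP/dQ, split r g² = g² + (r - 1) g². One factor |g| is bounded by K, and Cauchy–Schwarz
in L²(Q) handles |r - 1| |g|. -/
lemma integral_sq_le_of_chiSqDiv (h : chiSqDiv P Q < ⊤) {g : E → ℝ} (hg : Measurable g)
    (hgQ : Integrable (fun x => g x ^ 2) Q) {K : ℝ} (hK : 0 ≤ K) (hb : ∀ᵐ x ∂P, |g x| ≤ K) :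
    ∫ x, g x ^ 2 ∂P
      ≤ ∫ x, g x ^ 2 ∂Q + K * (√(chiSqDiv P Q).toReal * √(∫ x, g x ^ 2 ∂Q)) := by
  have hac := absolutelyContinuous_of_chiSqDiv_lt_top h
  have hgL : MemLp g 2 Q := (memLp_two_iff_integrable_sq hg.aestronglyMeasurable).2 hgQ
  have hrL := memLp_rnDeriv_sub_one h
  set r : E → ℝ := fun x => (P.rnDeriv Q x).toReal with hr
  -- The bound on `g` holds only `P`-almost everywhere. Truncating to `T` makes g² bounded
  -- everywhere, so that r f is `Q`-integrable, without changing the integral under `P`.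
  set T : Set E := {x | |g x| ≤ K} with hT
  have hTm : MeasurableSet T := measurableSet_le hg.abs measurable_const
  set f : E → ℝ := T.indicator fun x => g x ^ 2 with hf
  have hfm : Measurable f := (hg.pow_const 2).indicator hTm
  have hfb : ∀ x, ‖f x‖ ≤ K ^ 2 := fun x => by
    by_cases hx : x ∈ T
    · simp only [hf, Set.indicator_of_mem hx, Real.norm_eq_abs, abs_pow]
      exact pow_le_pow_left₀ (abs_nonneg _) hx 2
    · simp only [hf, Set.indicator_of_notMem hx, norm_zero]
      positivity
  have hfP : ∫ x, g x ^ 2 ∂P = ∫ x, f x ∂P := by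
    refine integral_congr_ae ?_
    filter_upwards [hb] with x hx
    rw [hf, Set.indicator_of_mem (show x ∈ T from hx)]
  have hrf : Integrable (fun x => r x * f x) Q :=
    Measure.integrable_toReal_rnDeriv.mul_bdd hfm.aestronglyMeasurable (ae_of_all _ hfb)
  have hrg : Integrable (fun x => |r x - 1| * |g x|) Q := hrL.abs.integrable_mul hgL.abs
  have hpt : ∀ x, r x * f x ≤ g x ^ 2 + K * (|r x - 1| * |g x|) := fun x => by
    by_cases hx : x ∈ T
    · have h1 : (r x - 1) * g x ^ 2 ≤ K * (|r x - 1| * |g x|) := by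
        calc (r x - 1) * g x ^ 2 ≤ |r x - 1| * g x ^ 2 := by gcongr; exact le_abs_self _
          _ = |g x| * (|r x - 1| * |g x|) := by rw [← sq_abs (g x)]; ring
          _ ≤ K * (|r x - 1| * |g x|) := by gcongr; exact hx
      simp only [hf, Set.indicator_of_mem hx]
      linarith
    · simp only [hf, Set.indicator_of_notMem hx, mul_zero]
      positivity
  calc ∫ x, g x ^ 2 ∂P = ∫ x, r x * f x ∂Q := by rw [hfP, integral_toReal_rnDeriv_mul hac]
    _ ≤ ∫ x, g x ^ 2 + K * (|r x - 1| * |g x|) ∂Q :=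
      integral_mono hrf (hgQ.add (hrg.const_mul K)) hpt
    _ = ∫ x, g x ^ 2 ∂Q + K * ∫ x, |r x - 1| * |g x| ∂Q := by
      rw [integral_add hgQ (hrg.const_mul K), integral_const_mul]
    _ ≤ _ := by
      have := integral_abs_mul_abs_le hrL hgL
      rw [integral_rnDeriv_sub_one_sq h] at this
      gcongr

/-- Settles the case 0 * ∞ below: when the divergence vanishes, no change of measure takes place. -/
lemma eq_of_chiSqDiv_eq_zero (h : chiSqDiv P Q = 0) : P = Q := by
  have hac : P ≪ Q := absolutelyContinuous_of_chiSqDiv_lt_top (h ▸ ENNReal.zero_lt_top)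
  have hmeas : Measurable fun x => (P.rnDeriv Q x).toReal - 1 :=
    (Measure.measurable_rnDeriv P Q).ennreal_toReal.sub_const 1
  rw [chiSqDiv_of_ac hac, lintegral_eq_zero_iff (hmeas.pow_const 2).ennreal_ofReal] at h
  have h1 : P.rnDeriv Q =ᵐ[Q] 1 := by
    filter_upwards [h] with x hx
    have hx' : ((P.rnDeriv Q x).toReal - 1) ^ 2 = 0 :=
      le_antisymm (ENNReal.ofReal_eq_zero.1 hx) (sq_nonneg _)
    have hx1 : (P.rnDeriv Q x).toReal = 1 := by linarith [pow_eq_zero_iff two_ne_zero |>.1 hx']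
    simpa using (ENNReal.toReal_eq_one_iff _).1 hx1
  rw [← Measure.withDensity_rnDeriv_eq P Q hac, withDensity_congr_ae h1, withDensity_one]

/-- The change of measure inequality with values in `[0, ∞]`, where `0 * ∞ = 0`. -/
lemma ofReal_integral_sq_le_of_chiSqDiv (h : chiSqDiv P Q < ⊤) {g : E → ℝ} (hg : Measurable g)
    (hgQ : Integrable (fun x => g x ^ 2) Q) {K : ℝ≥0∞}
    (hb : ∀ᵐ x ∂P, ENNReal.ofReal |g x| ≤ K) :
    ENNReal.ofReal (∫ x, g x ^ 2 ∂P) ≤ ENNReal.ofReal (∫ x, g x ^ 2 ∂Q)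
      + K * ENNReal.ofReal √(∫ x, g x ^ 2 ∂Q) * chiSqDiv P Q ^ (1 / 2 : ℝ) := by
  have hQ0 : 0 ≤ ∫ x, g x ^ 2 ∂Q := integral_nonneg fun _ => sq_nonneg _
  by_cases hK : K = ⊤
  -- With `K` infinite the right side is infinite unless another factor is 0. Either χ² = 0 and the
  -- measures agree, or g = 0 `Q`-a.e. and hence `P`-a.e.
  · by_cases hχ : chiSqDiv P Q = 0
    · rw [eq_of_chiSqDiv_eq_zero hχ]
      exact le_self_add
    by_cases hgz : ∫ x, g x ^ 2 ∂Q = 0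
    · have h0 := (integral_eq_zero_iff_of_nonneg (fun x => sq_nonneg (g x)) hgQ).1 hgz
      have h0P := (absolutelyContinuous_of_chiSqDiv_lt_top h).ae_le h0
      rw [integral_eq_zero_of_ae h0P]
      simp
    · have h1 : ENNReal.ofReal √(∫ x, g x ^ 2 ∂Q) ≠ 0 := by
        have : 0 < ∫ x, g x ^ 2 ∂Q := lt_of_le_of_ne hQ0 (Ne.symm hgz)
        simpa using this
      have h2 : chiSqDiv P Q ^ (1 / 2 : ℝ) ≠ 0 := by simp [hχ]
      rw [hK, ENNReal.top_mul h1, ENNReal.top_mul h2]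
      simp
  · have hb' : ∀ᵐ x ∂P, |g x| ≤ K.toReal := by
      filter_upwards [hb] with x hx
      exact (ENNReal.ofReal_le_iff_le_toReal hK).1 hx
    have key := integral_sq_le_of_chiSqDiv h hg hgQ ENNReal.toReal_nonneg hb'
    have hχr : chiSqDiv P Q ^ (1 / 2 : ℝ) = ENNReal.ofReal √(chiSqDiv P Q).toReal := by
      rw [Real.sqrt_eq_rpow, ← ENNReal.ofReal_rpow_of_nonneg ENNReal.toReal_nonneg (by norm_num),
        ENNReal.ofReal_toReal h.ne]
    have hKr : K = ENNReal.ofReal K.toReal := (ENNReal.ofReal_toReal hK).symm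
    refine (ENNReal.ofReal_le_ofReal key).trans (le_of_eq ?_)
    rw [ENNReal.ofReal_add hQ0 (by positivity), hχr,
      ENNReal.ofReal_mul ENNReal.toReal_nonneg, ENNReal.ofReal_mul (Real.sqrt_nonneg _), ← hKr]
    ring

end ChiSq

/-! ### Inequalities for the quadratic form -/

section DiagForm

variable {p : ℕ} {lam : Fin p → ℝ}

lemma diagForm_neg (lam v : Fin p → ℝ) : diagForm lam (-v) = diagForm lam v := by
  simp [diagForm]

/-- The difference is D(b) + 2⟨a + b, a⟩ - 2D(a), where ⟨·,·⟩ is the bilinear form of D.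
Cauchy–Schwarz bounds the inner product and the last term is dropped. -/
lemma diagForm_add_sub_le (h : ∀ i, 0 < lam i) (a b : Fin p → ℝ) :
    diagForm lam (a + b) - diagForm lam a
      ≤ diagForm lam b + 2 * (√(diagForm lam (a + b)) * √(diagForm lam a)) := by
  have hcs := Real.sum_sqrt_mul_sqrt_le Finset.univ
    (f := fun i => lam i * (a + b) i ^ 2) (g := fun i => lam i * a i ^ 2)
    (fun i => mul_nonneg (h i).le (sq_nonneg _)) (fun i => mul_nonneg (h i).le (sq_nonneg _))
  have hle : ∑ i, lam i * (a + b) i * a i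
      ≤ ∑ i, √(lam i * (a + b) i ^ 2) * √(lam i * a i ^ 2) := by
    refine Finset.sum_le_sum fun i _ => ?_
    rw [Real.sqrt_mul (h i).le, Real.sqrt_mul (h i).le, Real.sqrt_sq_eq_abs, Real.sqrt_sq_eq_abs]
    calc lam i * (a + b) i * a i = lam i * ((a + b) i * a i) := by ring
      _ ≤ lam i * |(a + b) i * a i| := mul_le_mul_of_nonneg_left (le_abs_self _) (h i).le
      _ = √(lam i) * |(a + b) i| * (√(lam i) * |a i|) := by
        rw [abs_mul]
        nth_rewrite 1 [← Real.mul_self_sqrt (h i).le]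
        ring
  have hid : diagForm lam (a + b) - diagForm lam a
      = diagForm lam b + 2 * ∑ i, lam i * (a + b) i * a i - 2 * diagForm lam a := by
    simp only [diagForm, Finset.mul_sum, ← Finset.sum_add_distrib, ← Finset.sum_sub_distrib,
      Pi.add_apply]
    exact Finset.sum_congr rfl fun i _ => by ring
  have ha := diagForm_nonneg h a
  have : ∑ i, lam i * (a + b) i * a i ≤ √(diagForm lam (a + b)) * √(diagForm lam a) :=
    hle.trans hcs
  linarith

lemma diagForm_add_le (h : ∀ i, 0 < lam i) (a b : Fin p → ℝ) :
    diagForm lam (a + b) ≤ 2 * diagForm lam a + 2 * diagForm lam b := by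
  simp only [diagForm, Finset.mul_sum, ← Finset.sum_add_distrib, Pi.add_apply]
  refine Finset.sum_le_sum fun i _ => ?_
  nlinarith [mul_nonneg (h i).le (sq_nonneg (a i - b i))]

/-- From D(a + b) ≤ 2D(a) + 2D(b) follows √D(a + b) ≤ 2√D(a) + √(2D(b)), with √2 rounded up to 2. -/
lemma sqrt_diagForm_add_mul_le (h : ∀ i, 0 < lam i) (a b : Fin p → ℝ) :
    2 * (√(diagForm lam (a + b)) * √(diagForm lam a))
      ≤ 4 * diagForm lam a + 2 * √(2 * diagForm lam b) * √(diagForm lam a) := by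
  have ha := diagForm_nonneg h a
  have hb := diagForm_nonneg h b
  have h1 : √(diagForm lam (a + b)) ≤ 2 * √(diagForm lam a) + √(2 * diagForm lam b) := by
    have hsa := Real.sq_sqrt ha
    have hsb := Real.sq_sqrt (mul_nonneg zero_le_two hb)
    refine Real.sqrt_le_iff.2 ⟨by positivity, (diagForm_add_le h a b).trans ?_⟩
    nlinarith [mul_nonneg (Real.sqrt_nonneg (diagForm lam a))
      (Real.sqrt_nonneg (2 * diagForm lam b))]
  have h2 := Real.mul_self_sqrt ha
  nlinarith [mul_le_mul_of_nonneg_right h1 (Real.sqrt_nonneg (diagForm lam a))]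

end DiagForm

/-! ### Positive variances and uniqueness of the optimal functions -/

section Positivity

variable {Ω : Type*} [MeasurableSpace Ω] {P : Measure Ω} [IsProbabilityMeasure P] {p : ℕ}
  {ν : Measure ((Fin p → ℝ) × ℝ)} [IsProbabilityMeasure ν] {lam : Fin p → ℝ} {σ : ℝ}

/-- Almost sure invertibility of the Gram matrix forces every feature to have positive variance. -/
lemma IsFeatureNoiseLaw.lam_pos (h : IsFeatureNoiseLaw ν lam σ) {x : ℕ → Ω → Fin p → ℝ}
    {ε : ℕ → Ω → ℝ} (hlaw : ∀ i, HasLaw (fun ω => (x i ω, ε i ω)) ν P) {n : ℕ}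
    (hinv : ∀ᵐ ω ∂P, IsUnit ((design n (fun i => x i ω))ᵀ * design n (fun i => x i ω)))
    (i : Fin p) : 0 < lam i := by
  have h0 : 0 ≤ lam i := h.var_feature i ▸ variance_nonneg _ _
  refine lt_of_le_of_ne h0 fun hz => ?_
  -- A centred feature of zero variance vanishes almost surely, which gives the Gram matrix a zero
  -- column.
  have hae := ae_eq_integral_of_variance_eq_zero (h.memLp_feature i)
    ((h.var_feature i).trans hz.symm)
  rw [h.mean_feature i] at hae
  have hx : ∀ᵐ ω ∂P, ∀ k, x k ω i = 0 := by
    rw [ae_all_iff]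
    intro k
    have hk : ∀ᵐ q ∂P.map fun ω => (x k ω, ε k ω), q.1 i = 0 := by
      rw [(hlaw k).map_eq]
      exact hae
    exact ae_of_ae_map (hlaw k).aemeasurable hk
  obtain ⟨ω, hω, hu⟩ := (hx.and hinv).exists
  have hdet := (Matrix.isUnit_iff_isUnit_det _).1 hu
  rw [Matrix.det_eq_zero_of_column_eq_zero i] at hdet
  · simp at hdet
  · intro j
    simp [Matrix.mul_apply, design, hω]

end Positivity

/-- The form is definite, so only the true coefficient vector attains the minimum 0. -/
lemma IsFeatureNoiseLaw.isOptimal_excessRisk_iff {p : ℕ}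
    {ν : Measure ((Fin p → ℝ) × ℝ)} {lam : Fin p → ℝ} {σ : ℝ} (h : IsFeatureNoiseLaw ν lam σ)
    (hpos : ∀ i, 0 < lam i) (β : Fin p → ℝ) (f : (Fin p → ℝ) → ℝ) :
    IsOptimal (linClass p) (excessRisk ν.fst (lin β)) f ↔ f = lin β := by
  constructor
  · rintro ⟨⟨γ, rfl⟩, hmin⟩
    have hγ := hmin (lin β) ⟨β, rfl⟩
    rw [h.excessRisk_lin, h.excessRisk_lin, sub_self, diagForm_zero] at hγ
    have := eq_zero_of_diagForm_eq_zero hpos (le_antisymm hγ (diagForm_nonneg hpos (γ - β)))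
    rw [sub_eq_zero.1 this]
  · rintro rfl
    refine ⟨⟨β, rfl⟩, ?_⟩
    rintro _ ⟨γ, rfl⟩
    rw [h.excessRisk_lin, h.excessRisk_lin, sub_self, diagForm_zero]
    exact diagForm_nonneg hpos (γ - β)

/-! ### The general utility bound and its trace form -/

section Bound

variable {p : ℕ} {ν νt : Measure ((Fin p → ℝ) × ℝ)} [IsProbabilityMeasure ν]
  [IsProbabilityMeasure νt] {lam lamt : Fin p → ℝ} {σ σt : ℝ}

lemma IsFeatureNoiseLaw.isOptimal_risk_iff (h : IsFeatureNoiseLaw ν lam σ)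
    (hpos : ∀ i, 0 < lam i) (β : Fin p → ℝ) (f : (Fin p → ℝ) → ℝ) :
    IsOptimal (linClass p) (risk (responseLaw β ν)) f ↔ f = lin β := by
  constructor
  · rintro ⟨⟨γ, rfl⟩, hmin⟩
    have hγ := hmin (lin β) ⟨β, rfl⟩
    rw [h.risk_lin, h.risk_lin, sub_self, diagForm_zero] at hγ
    have := eq_zero_of_diagForm_eq_zero hpos
      (le_antisymm (by linarith) (diagForm_nonneg hpos (γ - β)))
    rw [sub_eq_zero.1 this]
  · rintro rfl
    refine ⟨⟨β, rfl⟩, ?_⟩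
    rintro _ ⟨γ, rfl⟩
    rw [h.risk_lin, h.risk_lin, sub_self, diagForm_zero]
    linarith [diagForm_nonneg hpos (γ - β)]

lemma IsFeatureNoiseLaw.utility_lin (h : IsFeatureNoiseLaw ν lam σ) (β a b : Fin p → ℝ) :
    utility (responseLaw β ν) (lin (β + a + b)) (lin (β + a))
      = |diagForm lam (a + b) - diagForm lam a| := by
  rw [utility, h.risk_lin, h.risk_lin, show β + a + b - β = a + b by abel,
    add_sub_cancel_left, add_sub_add_right_eq_sub]

/-- Both regression functions are linear and hence optimal in the class, so their own excess risks
drop out of Υ₁ and Υ₂. -/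
lemma regressionUtilityBound_lin (h : IsFeatureNoiseLaw ν lam σ)
    (ht : IsFeatureNoiseLaw νt lamt σt) (hpos : ∀ i, 0 < lam i) (hpost : ∀ i, 0 < lamt i)
    (β a b : Fin p → ℝ) (M : ℝ≥0∞) :
    regressionUtilityBound (responseLaw β ν) (responseLaw (β + a) νt) (lin β) (lin (β + a))
        (lin (β + a)) (lin (β + a + b)) (lin β) (lin (β + a)) M
      = ENNReal.ofReal (diagForm lam a) + ENNReal.ofReal (diagForm lamt b)
        + 2 * M * ENNReal.ofReal (√(diagForm lamt b) + √(diagForm lamt a))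
          * chiSqDiv ν.fst νt.fst ^ (1 / 2 : ℝ)
        + ENNReal.ofReal
          (2 * (√(diagForm lam (a + b)) + 2 * √(diagForm lam a)) * √(diagForm lam a))
        + ENNReal.ofReal (4 * diagForm lam a) := by
  simp only [regressionUtilityBound, responseLaw_fst, h.risk_lin, ht.risk_lin, h.excessRisk_lin,
    ht.excessRisk_lin, sub_self, diagForm_zero, add_sub_cancel_left, sub_add_cancel_left,
    diagForm_neg, show β + a + b - β = a + b by abel, Real.sqrt_zero, mul_zero, add_zero,
    zero_add, add_sub_cancel_right, abs_of_nonneg (diagForm_nonneg hpos _),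
    abs_of_nonneg (diagForm_nonneg hpost _)]

lemma ofReal_utility_le_regressionUtilityBound (h : IsFeatureNoiseLaw ν lam σ)
    (ht : IsFeatureNoiseLaw νt lamt σt) (hpos : ∀ i, 0 < lam i) (hpost : ∀ i, 0 < lamt i)
    (hχ : chiSqDiv ν.fst νt.fst < ⊤) (β a b : Fin p → ℝ) {M : ℝ≥0∞}
    (hM : ∀ᵐ z ∂ν.fst, ENNReal.ofReal |lin (β + a) z| ≤ M ∧
      ENNReal.ofReal |lin (β + a + b) z| ≤ M) :
    ENNReal.ofReal (utility (responseLaw β ν) (lin (β + a + b)) (lin (β + a)))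
      ≤ regressionUtilityBound (responseLaw β ν) (responseLaw (β + a) νt) (lin β) (lin (β + a))
        (lin (β + a)) (lin (β + a + b)) (lin β) (lin (β + a)) M := by
  rw [regressionUtilityBound_lin h ht hpos hpost, h.utility_lin]
  have hDa := diagForm_nonneg hpos a
  have hDb := diagForm_nonneg hpos b
  have hDab := diagForm_nonneg hpos (a + b)
  have hb : ∀ᵐ z ∂ν.fst, ENNReal.ofReal |lin b z| ≤ 2 * M := by
    filter_upwards [hM] with z hz
    have hlin : lin b z = lin (β + a + b) z - lin (β + a) z := by
      rw [← lin_sub, add_sub_cancel_left]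
    calc ENNReal.ofReal |lin b z|
        ≤ ENNReal.ofReal (|lin (β + a + b) z| + |lin (β + a) z|) :=
          ENNReal.ofReal_le_ofReal (hlin ▸ abs_sub _ _)
      _ ≤ M + M := ENNReal.ofReal_add_le.trans (add_le_add hz.2 hz.1)
      _ = 2 * M := (two_mul M).symm
  have hcm := ofReal_integral_sq_le_of_chiSqDiv hχ (measurable_lin b)
    (ht.integrable_fst_lin_sq b) hb
  rw [h.integral_fst_lin_sq, ht.integral_fst_lin_sq] at hcm
  -- The upper side is `diagForm_add_sub_le`; the lower side only needs D(a) - D(a + b) ≤ D(a).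
  have hreal : |diagForm lam (a + b) - diagForm lam a| ≤ diagForm lam a + diagForm lam b
      + 2 * (√(diagForm lam (a + b)) + 2 * √(diagForm lam a)) * √(diagForm lam a) := by
    have h1 := diagForm_add_sub_le hpos a b
    have h2 : 0 ≤ √(diagForm lam (a + b)) * √(diagForm lam a) := by positivity
    have h3 := Real.mul_self_sqrt hDa
    rw [abs_le]
    constructor <;> nlinarith
  calc ENNReal.ofReal |diagForm lam (a + b) - diagForm lam a|
      ≤ ENNReal.ofReal (diagForm lam a) + ENNReal.ofReal (diagForm lam b)
        + ENNReal.ofReal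
          (2 * (√(diagForm lam (a + b)) + 2 * √(diagForm lam a)) * √(diagForm lam a)) := by
        rw [← ENNReal.ofReal_add hDa hDb, ← ENNReal.ofReal_add (by positivity) (by positivity)]
        exact ENNReal.ofReal_le_ofReal hreal
    _ ≤ ENNReal.ofReal (diagForm lam a) + (ENNReal.ofReal (diagForm lamt b)
          + 2 * M * ENNReal.ofReal (√(diagForm lamt b) + √(diagForm lamt a))
            * chiSqDiv ν.fst νt.fst ^ (1 / 2 : ℝ))
        + ENNReal.ofReal
          (2 * (√(diagForm lam (a + b)) + 2 * √(diagForm lam a)) * √(diagForm lam a)) := by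
        gcongr
        -- Change of measure for D(b). The summand √D̃(a) of the general bound is pure slack here,
        -- as is 4D(a) in the last step.
        refine hcm.trans ?_
        gcongr
        exact le_add_of_nonneg_right (Real.sqrt_nonneg _)
    _ ≤ _ := by
        rw [← add_assoc]
        exact le_self_add

lemma regressionUtilityBound_le_traceBound (h : IsFeatureNoiseLaw ν lam σ)
    (ht : IsFeatureNoiseLaw νt lamt σt) (hpos : ∀ i, 0 < lam i) (hpost : ∀ i, 0 < lamt i)
    {n m : ℕ} (β : Fin p → ℝ) (e : Fin n → ℝ) (Q : Matrix (Fin n) (Fin p) ℝ)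
    (et : Fin m → ℝ) (Qt : Matrix (Fin m) (Fin p) ℝ) (M : ℝ≥0∞) :
    regressionUtilityBound (responseLaw β ν) (responseLaw (β + Qᵀ *ᵥ e) νt) (lin β)
        (lin (β + Qᵀ *ᵥ e)) (lin (β + Qᵀ *ᵥ e)) (lin (β + Qᵀ *ᵥ e + Qtᵀ *ᵥ et)) (lin β)
        (lin (β + Qᵀ *ᵥ e)) M
      ≤ traceBound e Q et Qt lam lamt (chiSqDiv ν.fst νt.fst) M := by
  rw [regressionUtilityBound_lin h ht hpos hpost, traceBound]
  simp only [quadTrace_eq]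
  set a := Qᵀ *ᵥ e
  set b := Qtᵀ *ᵥ et
  have hDa := diagForm_nonneg hpos a
  have h3 := Real.mul_self_sqrt hDa
  -- The constant is 13 = 1 + 4 + 4 + 4: the original excess risk, the product 2 · 2√D(a) · √D(a),
  -- the final term 4D(a), and 4D(a) from `sqrt_diagForm_add_mul_le`.
  have hreal : diagForm lam a
      + 2 * (√(diagForm lam (a + b)) + 2 * √(diagForm lam a)) * √(diagForm lam a)
      + 4 * diagForm lam a
      ≤ 13 * diagForm lam a + 2 * √(2 * diagForm lam b) * √(diagForm lam a) := by
    have := sqrt_diagForm_add_mul_le hpos a b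
    nlinarith
  have hE := ENNReal.ofReal_le_ofReal hreal
  rw [ENNReal.ofReal_add (by positivity) (by positivity),
    ENNReal.ofReal_add (by positivity) (by positivity),
    ENNReal.ofReal_add (by positivity) (by positivity)] at hE
  calc _ = (ENNReal.ofReal (diagForm lam a) + ENNReal.ofReal
          (2 * (√(diagForm lam (a + b)) + 2 * √(diagForm lam a)) * √(diagForm lam a))
          + ENNReal.ofReal (4 * diagForm lam a)) + (ENNReal.ofReal (diagForm lamt b)
        + 2 * M * ENNReal.ofReal (√(diagForm lamt b) + √(diagForm lamt a))
          * chiSqDiv ν.fst νt.fst ^ (1 / 2 : ℝ)) := by ring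
    _ ≤ _ := add_le_add_left hE _
    _ = _ := by ring

end Bound

/-! ### Measurability of the least squares coefficients -/

section Measurability

variable {Ω : Type*} [MeasurableSpace Ω] {P : Measure Ω} {n p : ℕ}

lemma aemeasurable_det {A : Ω → Matrix (Fin p) (Fin p) ℝ}
    (hA : ∀ i j, AEMeasurable (fun ω => A ω i j) P) : AEMeasurable (fun ω => (A ω).det) P := by
  simp only [Matrix.det_apply]
  exact Finset.aemeasurable_fun_sum _ fun s _ =>
    (Finset.aemeasurable_fun_prod _ fun i _ => hA (s i) i).const_smul _

/-- Cramer's rule: the entries are adjugate entries over the determinant. Where the determinant is 0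
the inverse takes the default value 0, which is consistent with 0⁻¹ = 0. -/
lemma aemeasurable_nonsing_inv {A : Ω → Matrix (Fin p) (Fin p) ℝ}
    (hA : ∀ i j, AEMeasurable (fun ω => A ω i j) P) (i j : Fin p) :
    AEMeasurable (fun ω => (A ω)⁻¹ i j) P := by
  simp only [Matrix.inv_def, Ring.inverse_eq_inv', Matrix.smul_apply, smul_eq_mul,
    Matrix.adjugate_apply]
  refine (aemeasurable_det hA).inv.mul (aemeasurable_det fun k l => ?_)
  simp only [Matrix.updateRow_apply]
  split_ifs
  · exact aemeasurable_const
  · exact hA k l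

lemma aemeasurable_ols {A : Ω → Matrix (Fin n) (Fin p) ℝ} {Y : Ω → Fin n → ℝ}
    (hA : ∀ i j, AEMeasurable (fun ω => A ω i j) P) (hY : ∀ i, AEMeasurable (fun ω => Y ω i) P)
    (i : Fin p) : AEMeasurable (fun ω => ols (A ω) (Y ω) i) P := by
  have hG : ∀ i j, AEMeasurable (fun ω => ((A ω)ᵀ * A ω) i j) P := fun i j => by
    simp only [Matrix.mul_apply, Matrix.transpose_apply]
    exact Finset.aemeasurable_fun_sum _ fun k _ => (hA k i).mul (hA k j)
  simp only [ols, Matrix.mulVec, dotProduct, Matrix.mul_apply, Matrix.transpose_apply]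
  exact Finset.aemeasurable_fun_sum _ fun j _ => (Finset.aemeasurable_fun_sum _ fun k _ =>
    (aemeasurable_nonsing_inv hG i k).mul (hA j k)).mul (hY j)

/-- The vector β may be random, since the synthetic responses are generated from the fitted
coefficients. -/
lemma aemeasurable_ols_responses {x : ℕ → Ω → Fin p → ℝ} {ε : ℕ → Ω → ℝ} {β : Ω → Fin p → ℝ}
    (hx : ∀ k i, AEMeasurable (fun ω => x k ω i) P) (hε : ∀ k, AEMeasurable (ε k) P)
    (hβ : ∀ i, AEMeasurable (fun ω => β ω i) P) (i : Fin p) :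
    AEMeasurable (fun ω => ols (design n fun k => x k ω)
      (responses n (β ω) (fun k => x k ω) fun k => ε k ω) i) P := by
  refine aemeasurable_ols (fun k j => hx k j) (fun k => ?_) i
  simp only [responses, Pi.add_apply, Matrix.mulVec, dotProduct, noise, design, Matrix.of_apply]
  exact (Finset.aemeasurable_fun_sum _ fun j _ => (hx k j).mul (hβ j)).add (hε k)

lemma aemeasurable_diagForm {lam : Fin p → ℝ} {v : Ω → Fin p → ℝ}
    (hv : ∀ i, AEMeasurable (fun ω => v ω i) P) : AEMeasurable (fun ω => diagForm lam (v ω)) P :=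
  Finset.aemeasurable_fun_sum _ fun i _ => ((hv i).pow_const 2).const_mul _

end Measurability

/-! ### Consistency of least squares and the limit of the utility -/

section Consistency

variable {Ω : Type*} [MeasurableSpace Ω] {P : Measure Ω} {p : ℕ}
  {ν : Measure ((Fin p → ℝ) × ℝ)} [IsProbabilityMeasure ν] {lam : Fin p → ℝ} {σ : ℝ}
  {x : ℕ → Ω → Fin p → ℝ} {ε : ℕ → Ω → ℝ}

lemma ae_tendsto_average {E : Type*} [MeasurableSpace E] {ρ : Measure E} {Z : ℕ → Ω → E}
    (hlaw : ∀ i, HasLaw (Z i) ρ P) (hind : iIndepFun Z P) {φ : E → ℝ} (hφ : Measurable φ)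
    (hint : Integrable φ ρ) :
    ∀ᵐ ω ∂P, Tendsto (fun m : ℕ => (∑ k ∈ Finset.range m, φ (Z k ω)) / m) atTop
      (𝓝 (∫ q, φ q ∂ρ)) := by
  have hmean : ∫ ω, φ (Z 0 ω) ∂P = ∫ q, φ q ∂ρ :=
    (hlaw 0).integral_comp hφ.aestronglyMeasurable
  rw [← hmean]
  refine strong_law_ae_real (fun k ω => φ (Z k ω)) ?_ ?_ ?_
  · rw [← (hlaw 0).map_eq] at hint
    exact hint.comp_aemeasurable (hlaw 0).aemeasurable
  · intro i j hij
    exact (hind.indepFun hij).comp hφ hφ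
  · intro i
    have hZ : IdentDistrib (Z i) (Z 0) P P :=
      ⟨(hlaw i).aemeasurable, (hlaw 0).aemeasurable, (hlaw i).map_eq.trans (hlaw 0).map_eq.symm⟩
    exact hZ.comp hφ

/-- The factors m⁻¹ cancel; the error becomes a function of sample averages, to which the strong law
applies. -/
lemma qMat_transpose_mulVec_eq_average {m : ℕ} (hm : m ≠ 0) {A : Matrix (Fin m) (Fin p) ℝ}
    (h : IsUnit (Aᵀ * A)) (e : Fin m → ℝ) :
    (qMat A)ᵀ *ᵥ e = ((m : ℝ)⁻¹ • (Aᵀ * A))⁻¹ *ᵥ ((m : ℝ)⁻¹ • (Aᵀ *ᵥ e)) := by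
  have hm' : (m : ℝ) ≠ 0 := Nat.cast_ne_zero.2 hm
  let _ : Invertible (m : ℝ)⁻¹ := invertibleOfNonzero (inv_ne_zero hm')
  rw [qMat_transpose, Matrix.inv_smul _ _ ((Matrix.isUnit_iff_isUnit_det _).1 h),
    Matrix.smul_mulVec, Matrix.mulVec_smul, smul_smul, invOf_mul_self, one_smul,
    Matrix.mulVec_mulVec]

/-- The estimation error of least squares tends to zero almost surely. -/
lemma IsFeatureNoiseLaw.ae_tendsto_ols_error (h : IsFeatureNoiseLaw ν lam σ)
    (hpos : ∀ i, 0 < lam i) (hlaw : ∀ i, HasLaw (fun ω => (x i ω, ε i ω)) ν P)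
    (hind : iIndepFun (fun i ω => (x i ω, ε i ω)) P) {m₀ : ℕ}
    (hinv : ∀ m ≥ m₀, ∀ᵐ ω ∂P,
      IsUnit ((design m (fun i => x i ω))ᵀ * design m (fun i => x i ω))) :
    ∀ᵐ ω ∂P, Tendsto (fun m => (qMat (design m fun i => x i ω))ᵀ *ᵥ noise m fun i => ε i ω)
      atTop (𝓝 0) := by
  have hG : ∀ᵐ ω ∂P, ∀ i j, Tendsto
      (fun m : ℕ => (∑ k ∈ Finset.range m, x k ω i * x k ω j) / m) atTop
      (𝓝 (if i = j then lam i else 0)) := by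
    simp_rw [ae_all_iff]
    intro i j
    rw [← h.integral_feature_mul i j]
    exact ae_tendsto_average hlaw hind (φ := fun q => q.1 i * q.1 j) (by fun_prop)
      (h.integrable_feature_mul i j)
  have hc : ∀ᵐ ω ∂P, ∀ i, Tendsto
      (fun m : ℕ => (∑ k ∈ Finset.range m, x k ω i * ε k ω) / m) atTop (𝓝 0) := by
    simp_rw [ae_all_iff]
    intro i
    rw [← h.integral_feature_mul_noise i]
    exact ae_tendsto_average hlaw hind (φ := fun q => q.1 i * q.2) (by fun_prop)
      (h.integrable_feature_mul_noise i)
  have hu : ∀ᵐ ω ∂P, ∀ m ≥ m₀,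
      IsUnit ((design m (fun i => x i ω))ᵀ * design m (fun i => x i ω)) := by
    simp_rw [ae_all_iff]
    exact hinv
  filter_upwards [hG, hc, hu] with ω hGω hcω huω
  set A : (m : ℕ) → Matrix (Fin m) (Fin p) ℝ := fun m => design m fun i => x i ω with hA
  have hGlim : Tendsto (fun m : ℕ => (m : ℝ)⁻¹ • ((A m)ᵀ * A m)) atTop
      (𝓝 (Matrix.diagonal lam)) := by
    refine tendsto_pi_nhds.2 fun i => tendsto_pi_nhds.2 fun j => ?_
    rw [Matrix.diagonal_apply]
    refine (hGω i j).congr fun m => ?_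
    rw [Matrix.smul_apply, Matrix.mul_apply, smul_eq_mul, div_eq_inv_mul, Finset.sum_range]
    rfl
  have hclim : Tendsto (fun m : ℕ => (m : ℝ)⁻¹ • ((A m)ᵀ *ᵥ noise m fun i => ε i ω)) atTop
      (𝓝 0) := by
    refine tendsto_pi_nhds.2 fun i => (hcω i).congr fun m => ?_
    rw [Pi.smul_apply, smul_eq_mul, div_eq_inv_mul, Finset.sum_range]
    rfl
  have hdet : (Matrix.diagonal lam).det ≠ 0 := by
    rw [Matrix.det_diagonal]
    exact Finset.prod_ne_zero_iff.2 fun i _ => (hpos i).ne'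
  -- The limiting Gram matrix is diagonal with positive entries, so inversion is continuous there.
  have hinvlim : Tendsto (fun m : ℕ => ((m : ℝ)⁻¹ • ((A m)ᵀ * A m))⁻¹) atTop
      (𝓝 (Matrix.diagonal lam)⁻¹) := by
    have hcont : ContinuousAt (fun M : Matrix (Fin p) (Fin p) ℝ => M⁻¹) (Matrix.diagonal lam) := by
      refine continuousAt_matrix_inv _ ?_
      simpa only [Ring.inverse_eq_inv'] using continuousAt_inv₀ hdet
    exact hcont.tendsto.comp hGlim
  have hmul : Continuous fun r : Matrix (Fin p) (Fin p) ℝ × (Fin p → ℝ) => r.1 *ᵥ r.2 :=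
    continuous_fst.matrix_mulVec continuous_snd
  have hlim := (hmul.tendsto ((Matrix.diagonal lam)⁻¹, 0)).comp (hinvlim.prodMk_nhds hclim)
  simp only [Matrix.mulVec_zero] at hlim
  refine hlim.congr' ?_
  filter_upwards [eventually_ge_atTop m₀, eventually_ne_atTop 0] with m hm hm0
  exact (qMat_transpose_mulVec_eq_average hm0 (huω m hm) _).symm

/-- For a fixed original sample size, the utility gap tends to zero in probability as the size of
the synthetic sample tends to infinity. -/
lemma tendsto_measure_utility_gt {Ω : Type*} [MeasurableSpace Ω] {P : Measure Ω}
    [IsProbabilityMeasure P] {p : ℕ} {ν νt : Measure ((Fin p → ℝ) × ℝ)} [IsProbabilityMeasure ν]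
    [IsProbabilityMeasure νt] {lam lamt : Fin p → ℝ} {σ σt : ℝ} (h : IsFeatureNoiseLaw ν lam σ)
    (ht : IsFeatureNoiseLaw νt lamt σt) (hpost : ∀ i, 0 < lamt i) (βs : Fin p → ℝ)
    {x : ℕ → Ω → Fin p → ℝ} {ε : ℕ → Ω → ℝ} {xt : ℕ → Ω → Fin p → ℝ} {εt : ℕ → Ω → ℝ}
    (hmeas : ∀ i, AEMeasurable (fun ω => (x i ω, ε i ω)) P)
    (hlawt : ∀ i, HasLaw (fun ω => (xt i ω, εt i ω)) νt P)
    (hindt : iIndepFun (fun i ω => (xt i ω, εt i ω)) P) {m₀ : ℕ}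
    (hinvt : ∀ m ≥ m₀, ∀ᵐ ω ∂P,
      IsUnit ((design m (fun i => xt i ω))ᵀ * design m (fun i => xt i ω)))
    (n : ℕ) {δ : ℝ} (hδ : 0 < δ) :
    Tendsto (fun m => P {ω |
        δ < utility (responseLaw βs ν)
          (lin (betaTilde n m βs (fun i => x i ω) (fun i => ε i ω)
            (fun i => xt i ω) (fun i => εt i ω)))
          (lin (betaHat n βs (fun i => x i ω) (fun i => ε i ω)))})
      atTop (𝓝 0) := by
  have hx : ∀ k i, AEMeasurable (fun ω => x k ω i) P := fun k i =>
    ((measurable_pi_apply i).comp measurable_fst).comp_aemeasurable (hmeas k)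
  have hε : ∀ k, AEMeasurable (ε k) P := fun k => measurable_snd.comp_aemeasurable (hmeas k)
  have hxt : ∀ k i, AEMeasurable (fun ω => xt k ω i) P := fun k i =>
    ((measurable_pi_apply i).comp measurable_fst).comp_aemeasurable (hlawt k).aemeasurable
  have hεt : ∀ k, AEMeasurable (εt k) P := fun k =>
    measurable_snd.comp_aemeasurable (hlawt k).aemeasurable
  set bh : Ω → Fin p → ℝ := fun ω => betaHat n βs (fun i => x i ω) (fun i => ε i ω)
  set bt : ℕ → Ω → Fin p → ℝ := fun m ω => betaTilde n m βs (fun i => x i ω) (fun i => ε i ω)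
    (fun i => xt i ω) (fun i => εt i ω)
  set U : ℕ → Ω → ℝ := fun m ω => utility (responseLaw βs ν) (lin (bt m ω)) (lin (bh ω)) with hU
  -- The noise variance cancels, so the utility is an explicit continuous function of the two
  -- coefficient vectors; measurability and the limit both rest on this.
  have hUeq : ∀ m ω, U m ω = |diagForm lam (bt m ω - βs) - diagForm lam (bh ω - βs)| :=
    fun m ω => by
      simp only [hU, utility, h.risk_lin, add_sub_add_right_eq_sub]
  have hbh : ∀ i, AEMeasurable (fun ω => bh ω i) P :=
    aemeasurable_ols_responses hx hε fun _ => aemeasurable_const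
  have hbt : ∀ m i, AEMeasurable (fun ω => bt m ω i) P := fun m =>
    aemeasurable_ols_responses hxt hεt hbh
  have hUmeas : ∀ m, AEStronglyMeasurable (U m) P := fun m => by
    rw [funext (hUeq m)]
    exact (((aemeasurable_diagForm fun i => (hbt m i).sub_const _).sub
      (aemeasurable_diagForm fun i => (hbh i).sub_const _)).abs).aestronglyMeasurable
  have hu : ∀ᵐ ω ∂P, ∀ m ≥ m₀,
      IsUnit ((design m (fun i => xt i ω))ᵀ * design m (fun i => xt i ω)) := by
    simp_rw [ae_all_iff]
    exact hinvt
  have hlim : ∀ᵐ ω ∂P, Tendsto (fun m => U m ω) atTop (𝓝 0) := by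
    filter_upwards [ht.ae_tendsto_ols_error hpost hlawt hindt hinvt, hu] with ω hω huω
    have hbtlim : Tendsto (fun m => bt m ω) atTop (𝓝 (bh ω)) := by
      have hadd := hω.const_add (bh ω)
      rw [add_zero] at hadd
      refine hadd.congr' ?_
      filter_upwards [eventually_ge_atTop m₀] with m hm
      exact (ols_responses (bh ω) _ (huω m hm)).symm
    have hcont : Continuous fun v : Fin p → ℝ =>
        |diagForm lam (v - βs) - diagForm lam (bh ω - βs)| := by
      unfold diagForm
      fun_prop
    have hcomp := (hcont.tendsto (bh ω)).comp hbtlim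
    rw [sub_self, abs_zero] at hcomp
    exact hcomp.congr fun m => (hUeq m ω).symm
  have hmeasure := tendstoInMeasure_iff_dist.1 (tendstoInMeasure_of_tendsto_ae hUmeas hlim) δ hδ
  -- Convergence in measure concerns the event δ ≤ |U|, which contains the strict event δ < U.
  refine tendsto_of_tendsto_of_tendsto_of_le_of_le tendsto_const_nhds hmeasure
    (fun _ => zero_le) fun m => measure_mono fun ω hω => ?_
  have hω' : δ < U m ω := hω
  simpa using hω'.le.trans (le_abs_self (U m ω))

end Consistency

end SyntheticLR

end

/-! ### The theorem -/

open SyntheticLR in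
theorem theorem3 {Ω : Type*} [MeasurableSpace Ω] (P : Measure Ω) [IsProbabilityMeasure P]
    {p : ℕ}
    -- laws of (feature, noise) for the original and the synthetic data
    (ν νt : Measure ((Fin p → ℝ) × ℝ)) [IsProbabilityMeasure ν] [IsProbabilityMeasure νt]
    (lam lamt : Fin p → ℝ) (σ σt : ℝ)
    (hν : IsFeatureNoiseLaw ν lam σ) (hνt : IsFeatureNoiseLaw νt lamt σt)
    (hbdd : ∃ C : ℝ, ∀ᵐ q ∂νt, |q.2| ≤ C)
    (hχ : chiSqDiv ν.fst νt.fst < ⊤)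
    (βs : Fin p → ℝ)
    -- the original and the synthetic samples: i.i.d., and independent of each other
    (x : ℕ → Ω → Fin p → ℝ) (ε : ℕ → Ω → ℝ) (xt : ℕ → Ω → Fin p → ℝ) (εt : ℕ → Ω → ℝ)
    (hlaw : ∀ i, HasLaw (fun ω => (x i ω, ε i ω)) ν P)
    (hlawt : ∀ i, HasLaw (fun ω => (xt i ω, εt i ω)) νt P)
    (hind : iIndepFun (fun i ω => (x i ω, ε i ω)) P)
    (hindt : iIndepFun (fun i ω => (xt i ω, εt i ω)) P)
    (hcross : IndepFun (fun ω i => (x i ω, ε i ω)) (fun ω i => (xt i ω, εt i ω)) P)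
    -- almost sure invertibility, which can only hold from some sample size on
    (n₀ m₀ : ℕ)
    (hinv : ∀ n ≥ n₀, ∀ᵐ ω ∂P,
      IsUnit ((design n (fun i => x i ω))ᵀ * design n (fun i => x i ω)))
    (hinvt : ∀ m ≥ m₀, ∀ᵐ ω ∂P,
      IsUnit ((design m (fun i => xt i ω))ᵀ * design m (fun i => xt i ω)))
    -- the feature domain
    (S : Set (Fin p → ℝ)) (hS : ∀ᵐ z ∂ν.fst, z ∈ S) :
    (∀ n ≥ n₀, ∀ m ≥ m₀, ∀ᵐ ω ∂P,
      let X := fun i => x i ω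
      let e := fun i => ε i ω
      let Xt := fun i => xt i ω
      let et := fun i => εt i ω
      let βhat := betaHat n βs X e
      let fhat := lin βhat
      let ft := lin (betaTilde n m βs X e Xt et)
      let PXY := responseLaw βs ν
      let PXYt := responseLaw βhat νt
      let Q := qMat (design n X)
      let Qt := qMat (design m Xt)
      let M := supBound S Q (responses n βs X e) Qt (responses m βhat Xt et)
      let B := traceBound (noise n e) Q (noise m et) Qt lam lamt (chiSqDiv ν.fst νt.fst) M
      ENNReal.ofReal (utility PXY ft fhat) ≤ B ∧
      -- this is what the general bound becomes
      ∀ fs fts, IsOptimal (linClass p) (risk PXY) fs →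
        IsOptimal (linClass p) (excessRisk νt.fst fhat) fts →
        ENNReal.ofReal (utility PXY ft fhat)
            ≤ regressionUtilityBound PXY PXYt (lin βs) fhat fhat ft fs fts M ∧
          regressionUtilityBound PXY PXYt (lin βs) fhat fhat ft fs fts M ≤ B) ∧
    ∀ δ : ℝ, 0 < δ → ∃ L : ℕ → ℝ≥0∞,
      (∀ n ≥ n₀, Tendsto (fun m => P {ω |
          δ < utility (responseLaw βs ν)
            (lin (betaTilde n m βs (fun i => x i ω) (fun i => ε i ω)
              (fun i => xt i ω) (fun i => εt i ω)))
            (lin (betaHat n βs (fun i => x i ω) (fun i => ε i ω)))})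
        atTop (𝓝 (L n))) ∧
      Tendsto L atTop (𝓝 0) := by
  have hpos : ∀ i, 0 < lam i := hν.lam_pos hlaw (hinv n₀ le_rfl)
  have hpost : ∀ i, 0 < lamt i := hνt.lam_pos hlawt (hinvt m₀ le_rfl)
  refine ⟨fun n hn m hm => ?_, fun δ hδ => ⟨fun _ => 0, fun n _ => ?_, tendsto_const_nhds⟩⟩
  · filter_upwards [hinv n hn, hinvt m hm] with ω hu hut
    intro X e Xt et βhat fhat ft PXY PXYt Q Qt M B
    have hhat : βhat = βs + Qᵀ *ᵥ noise n e := ols_responses βs e hu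
    have htilde : betaTilde n m βs X e Xt et = βs + Qᵀ *ᵥ noise n e + Qtᵀ *ᵥ noise m et := by
      rw [← hhat]
      exact ols_responses βhat et hut
    have hM : ∀ᵐ z ∂ν.fst, ENNReal.ofReal |lin βhat z| ≤ M ∧
        ENNReal.ofReal |lin (betaTilde n m βs X e Xt et) z| ≤ M := by
      -- On `S` the fitted values are among those whose supremum defines `M`, because the
      -- coefficients are QᵀY and Q̃ᵀỸ.
      filter_upwards [hS] with z hz
      have h₁ : βhat = Qᵀ *ᵥ responses n βs X e := ols_eq_qMat _ _
      have h₂ : betaTilde n m βs X e Xt et = Qtᵀ *ᵥ responses m βhat Xt et := ols_eq_qMat _ _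
      exact ⟨h₁.symm ▸ le_supBound_left hz _ _ _ _, h₂.symm ▸ le_supBound_right hz _ _ _ _⟩
    rw [hhat, htilde] at hM
    have hgen := ofReal_utility_le_regressionUtilityBound hν hνt hpos hpost hχ βs _ _ hM
    have htr := regressionUtilityBound_le_traceBound hν hνt hpos hpost βs (noise n e) Q
      (noise m et) Qt M
    rw [← htilde, ← hhat] at hgen htr
    refine ⟨hgen.trans htr, fun fs fts hfs hfts => ?_⟩
    obtain rfl := (hν.isOptimal_risk_iff hpos βs fs).1 hfs
    obtain rfl := (hνt.isOptimal_excessRisk_iff hpost βhat fts).1 hfts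
    exact ⟨hgen, htr⟩
  · exact tendsto_measure_utility_gt hν hνt hpost βs (fun i => (hlaw i).aemeasurable) hlawt hindt
      hinvt n hδ
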